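/- Let $\mathrm{GL}^+(3)=\{F\in\mathbb R^{3\times3}:\det F>0\}$, let $\mathrm{Sym}(3)$ be the space of symmetric real $3\times3$ matrices, let $\langle X,Y\rangle=\operatorname{tr}(XY^{\mathsf T})$ with Frobenius norm $\|X\|=\sqrt{\langle X,X\rangle}$, and let $\operatorname{cof}F=\det(F)\,F^{-\mathsf T}$. Let $\alpha\ge 1$, $\beta>3^{\alpha/2}$, $\gamma\ge\tfrac14$ and $\kappa\in\mathbb R$, and define $W:\mathrm{GL}^+(3)\to\mathbb R\cup\{\infty\}$ by $$W(F)=-\log\bigl(\beta-\|F\|^\alpha\bigr)-\gamma\log\det F+\Bigl(\gamma-\alpha\,\frac{3^{\alpha/2-1}}{\beta-3^{\alpha/2}}\Bigr)\det F+\kappa\quad\text{if }\|F\|^\alpha<\beta,\qquad W(F)=\infty\ \text{ otherwise.}$$ For $X\in\mathrm{Sym}(3)$ (the Hencky strain $X=\log V$, where $V=\sqrt{FF^{\mathsf T}}$ is the left stretch tensor) put $\widehat W(X)=W(\exp X)$; let $\mathcal C=\{X\in\mathrm{Sym}(3):\widehat W(X)<\infty\}$ be the set of admissible Hencky strains, and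 let $\widehat\sigma(X)=\frac{1}{\det\exp X}\,\mathrm D_X\widehat W(X)\in\mathrm{Sym}(3)$ be the Cauchy stress, where $\mathrm D_X\widehat W$ is the gradient in $\mathrm{Sym}(3)$ with respect to $\langle\cdot,\cdot\rangle$. Then: 1. $W$ is polyconvex: there is a convex function $\mathcal P:\mathbb R^{3\times3}\times\mathbb R^{3\times3}\times(0,\infty)\to\mathbb R\cup\{\infty\}$ with $W(F)=\mathcal P(F,\operatorname{cof}F,\det F)$ for all $F\in\mathrm{GL}^+(3)$. 2. The constraint set $\{F\in\mathbb R^{3\times3}:\|F\|^\alpha<\beta\}$ is convex, and so is $\mathcal C$. 3. (TSTS-M$^{++}$ on $\mathcal C$) $\widehat W$ and $\widehat\sigma$ are differentiable at every $X\in\mathcal C$, and $\langle \mathrm D\widehat\sigma(X).H,H\rangle>0$ for all $X\in\mathcal C$ and all $H\in\mathrm{Sym}(3)\setminus\{0\}$. 4. (TSTS-M$^{+}$ on $\mathcal C$) $\langle\widehat\sigma(Y)-\widehat\sigma(X),Y-X\rangle>0$ for all $X,Y\in\mathcal C$ with $X\ne Y$. -/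

import Mathlib

open scoped Matrix RealInnerProductSpace Gradient

namespace ChainLimited

/-- Second-order tensors in three dimensions. -/
abbrev Mat : Type := Matrix (Fin 3) (Fin 3) ℝ

/-- The double contraction `⟨X, Y⟩ = tr (X Yᵀ)`. -/
def contract (X Y : Mat) : ℝ := (X * Yᵀ).trace

/-- The Frobenius norm `‖X‖ = √⟨X, X⟩`. -/
noncomputable def frobNorm (X : Mat) : ℝ := Real.sqrt (contract X X)

theorem contract_self (X : Mat) : contract X X = ∑ i, ∑ j, X i j ^ 2 := by
  simp [contract, Matrix.trace, Matrix.mul_apply, pow_two]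

theorem contract_self_nonneg (X : Mat) : 0 ≤ contract X X := by
  rw [contract_self]
  positivity

theorem contract_self_eq_zero {X : Mat} (h : contract X X = 0) : X = 0 := by
  rw [contract_self, Finset.sum_eq_zero_iff_of_nonneg (fun _ _ => by positivity)] at h
  ext i j
  have hi := h i (Finset.mem_univ i)
  rw [Finset.sum_eq_zero_iff_of_nonneg (fun _ _ => by positivity)] at hi
  simpa using hi j (Finset.mem_univ j)

/-- The symmetric tensors as a subspace of all tensors. -/
def symSubmodule : Submodule ℝ Mat where
  carrier := {X | X.IsSymm}
  add_mem' hX hY := Matrix.IsSymm.add hX hY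
  zero_mem' := Matrix.isSymm_zero
  smul_mem' c _ hX := Matrix.IsSymm.smul hX c

/-- `Sym(3)`, the space of symmetric tensors, as a type of its own: its topology is that of the
inner product `⟨X, Y⟩ = tr (X Yᵀ)` below. -/
def Sym3 : Type := symSubmodule

instance : AddCommGroup Sym3 := inferInstanceAs (AddCommGroup symSubmodule)

instance : Module ℝ Sym3 := inferInstanceAs (Module ℝ symSubmodule)

instance : FiniteDimensional ℝ Sym3 := inferInstanceAs (FiniteDimensional ℝ symSubmodule)

/-- The inclusion of `Sym(3)` into the space of all tensors. -/
def Sym3.toMat : Sym3 →ₗ[ℝ] Mat := symSubmodule.subtype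

theorem Sym3.isSymm (X : Sym3) : X.toMat.IsSymm := X.2

theorem Sym3.toMat_injective : Function.Injective Sym3.toMat := Subtype.val_injective

noncomputable instance sym3Core : InnerProductSpace.Core ℝ Sym3 where
  inner X Y := contract X.toMat Y.toMat
  conj_inner_symm X Y := by
    simp only [contract, conj_trivial]
    rw [← Matrix.trace_transpose]
    simp
  re_inner_nonneg X := contract_self_nonneg _
  add_left X Y Z := by simp [contract, add_mul]
  smul_left X Y r := by simp [contract]
  definite X h := Sym3.toMat_injective (by simpa using contract_self_eq_zero h)

noncomputable instance : NormedAddCommGroup Sym3 := sym3Core.toNormedAddCommGroup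

noncomputable instance : InnerProductSpace ℝ Sym3 := InnerProductSpace.ofCore sym3Core.toCore

theorem Sym3.inner_def (X Y : Sym3) : ⟪X, Y⟫ = contract X.toMat Y.toMat := rfl

instance : CompleteSpace Sym3 := FiniteDimensional.complete ℝ Sym3

/-- `GL⁺(3)`, the tensors with positive determinant. -/
abbrev GLPlus : Type := {F : Mat // 0 < F.det}

/-- The cofactor `det(F) F⁻ᵀ`. -/
noncomputable def cof (F : GLPlus) : Mat := F.1.det • (F.1⁻¹)ᵀ

/-- Convexity of an extended-real-valued function that never takes the value `-∞`,
on the convex set `D`. -/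
def IsConvexExt {E : Type*} [AddCommGroup E] [Module ℝ E] (D : Set E) (P : E → EReal) : Prop :=
  Convex ℝ D ∧ (∀ x ∈ D, P x ≠ ⊥) ∧
    ∀ x ∈ D, ∀ y ∈ D, ∀ a b : ℝ, 0 < a → 0 < b → a + b = 1 →
      P (a • x + b • y) ≤ (a : EReal) * P x + (b : EReal) * P y

/-- Polyconvexity of `W : GL⁺(3) → ℝ ∪ {∞}`: there is a convex function `P(F, G, δ)` on
`ℝ³ˣ³ × ℝ³ˣ³ × ℝ⁺` with `W(F) = P(F, cof F, det F)`. -/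
def Polyconvex (W : GLPlus → EReal) : Prop :=
  ∃ P : Mat × Mat × ℝ → EReal,
    IsConvexExt {p : Mat × Mat × ℝ | 0 < p.2.2} P ∧
      ∀ F : GLPlus, W F = P (F.1, cof F, F.1.det)

theorem det_exp_pos (X : Mat) : 0 < (NormedSpace.exp X).det := by
  have h : NormedSpace.exp X
      = NormedSpace.exp ((1 / 2 : ℝ) • X) * NormedSpace.exp ((1 / 2 : ℝ) • X) := by
    rw [← Matrix.exp_add_of_commute _ _ (Commute.refl _), ← add_smul]
    norm_num
  have hu := (Matrix.isUnit_iff_isUnit_det _).1 (Matrix.isUnit_exp ((1 / 2 : ℝ) • X))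
  rw [h, Matrix.det_mul]
  exact mul_self_pos.2 hu.ne_zero

/-- The stretch tensor `V = exp(log V)` belonging to a Hencky strain `X = log V`. -/
noncomputable def stretch (X : Sym3) : GLPlus :=
  ⟨NormedSpace.exp X.toMat, det_exp_pos _⟩

/-- The set of admissible Hencky strains, i.e. those at which the energy is finite. -/
def admissible (W : GLPlus → EReal) : Set Sym3 := {X | W (stretch X) < ⊤}

/-- `Ŵ(log V) = W(V)`: the energy of an objective isotropic material as a function of the
Hencky strain (the value off the set of admissible strains is immaterial). -/
noncomputable def energyHat (W : GLPlus → EReal) (X : Sym3) : ℝ := (W (stretch X)).toReal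

/-- The Cauchy stress `σ̂(log V) = J⁻¹ D_{log V} Ŵ(log V)`, where `J = det V`; the gradient is
taken in `Sym(3)`. -/
noncomputable def cauchyStress (W : GLPlus → EReal) (X : Sym3) : Sym3 :=
  (stretch X).1.det⁻¹ • ∇ (energyHat W) X

/-- TSTS-M⁺⁺ on the admissible Hencky strains: the energy and the Cauchy stress are
differentiable there, and the derivative of the Cauchy stress is positive definite. -/
def TSTSMPlusPlus (W : GLPlus → EReal) : Prop :=
  ∀ X ∈ admissible W,
    DifferentiableAt ℝ (energyHat W) X ∧ DifferentiableAt ℝ (cauchyStress W) X ∧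
      ∀ H : Sym3, H ≠ 0 → 0 < ⟪fderiv ℝ (cauchyStress W) X H, H⟫

/-- TSTS-M⁺ on the admissible Hencky strains: the energy is differentiable there, and the
Cauchy stress is strictly monotone. -/
def TSTSMPlus (W : GLPlus → EReal) : Prop :=
  (∀ X ∈ admissible W, DifferentiableAt ℝ (energyHat W) X) ∧
    ∀ X ∈ admissible W, ∀ Y ∈ admissible W, X ≠ Y →
      0 < ⟪cauchyStress W Y - cauchyStress W X, Y - X⟫

open Classical in
/-- The chain-limited strain energy with parameters `α, β, γ` and additive constant `κ`. -/
noncomputable def chainEnergy (α β γ κ : ℝ) (F : GLPlus) : EReal :=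
  if frobNorm F.1 ^ α < β then
    ((-Real.log (β - frobNorm F.1 ^ α) - γ * Real.log F.1.det
      + (γ - α * ((3 : ℝ) ^ (α / 2 - 1) / (β - (3 : ℝ) ^ (α / 2)))) * F.1.det + κ : ℝ) : EReal)
  else ⊤

/-- The energy depends on `F` only through `B = F Fᵀ`, and so is a function of `log V`, where
`exp(log V)² = B`. -/
theorem chainEnergy_eq_stretch (α β γ κ : ℝ) (F : GLPlus) (X : Sym3)
    (h : (stretch X).1 * (stretch X).1 = F.1 * F.1ᵀ) :
    chainEnergy α β γ κ F = chainEnergy α β γ κ (stretch X) := by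
  have hs : (stretch X).1ᵀ = (stretch X).1 := Matrix.IsSymm.exp X.isSymm
  have hn : frobNorm F.1 = frobNorm (stretch X).1 := by
    simp only [frobNorm, contract, hs, h]
  have hd : F.1.det = (stretch X).1.det := by
    rw [← sq_eq_sq₀ F.2.le (stretch X).2.le]
    have := congrArg Matrix.det h
    simp only [Matrix.det_mul, Matrix.det_transpose] at this
    rw [pow_two, pow_two, this]
  simp only [chainEnergy, hn, hd]

end ChainLimited

/-!
Write `X` for the Hencky strain, `B = exp(2X)`, `s = tr B = ‖V‖²`, `t = tr H`, and `c` for the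
constant `α 3^{α/2-1} / (β - 3^{α/2})`. Since `det exp X = exp (tr X)`, the Cauchy stress on the
(open) set of admissible strains is
`σ̂(X) = exp(-tr X) (h(s) B - γ I) + (γ - c) I` with `h(s) = α s^{α/2-1} / (β - s^{α/2})`.
With `m = ⟨B, H⟩` and `l = ⟨D exp(2X).H, H⟩`, differentiation gives
`exp(tr X) ⟨D σ̂(X).H, H⟩ = γ t² - h t m + 2 h'(s) m² + 2 h l`, where
`h'(s) = h ((α/2 - 1)/s + h/2)`. The Cauchy–Schwarz inequality `m² ≤ l s` and `γ ≥ 1/4` bound this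
below by `(t/2 - h m)² + h α m² / s`, and the strict inequality `l > 0` deals with the case `m = 0`
(`quadratic_form_pos`).

The properties of `l` come from the derivative of the matrix exponential at a symmetric matrix
`A` (`exists_fderiv_exp_eq_conj`): in an eigenbasis of `A` it multiplies the entries of `H` by the
divided differences of `exp`, which are positive. This follows from two algebraic rules valid in
every Banach algebra: `D exp(A).H = exp(A) H` if `H` commutes with `A`, and
`D exp(A).[K, A] = [K, exp A]`. Hence `D exp(A)` is positive definite
(`trace_fderiv_exp_mul_transpose_pos`), and since it maps the identity to `exp A`, the
Cauchy–Schwarz inequality for its quadratic form yields `m² ≤ l s` (`sq_trace_exp_mul_le`).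

The positivity of `l` also makes `X ↦ tr exp(2X)` convex (`convexOn_stretchSq`), so that its
sublevel set of admissible strains is convex, and strict monotonicity follows because
`⟨σ̂(X + τ(Y - X)), Y - X⟩` has a positive derivative in `τ`
(`inner_sub_pos_of_hasFDerivAt_pos`). Polyconvexity (`polyconvex_chainEnergy`) holds because
`-log` is convex and decreasing while `‖F‖^α` is convex.
-/

namespace ChainLimited

/-! ### The derivative of the exponential in a Banach algebra -/

section BanachAlgebra

variable {𝔸 : Type*} [NormedRing 𝔸] [NormedAlgebra ℝ 𝔸] [CompleteSpace 𝔸]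

open NormedSpace

theorem hasFDerivAt_exp_fderiv (A : 𝔸) : HasFDerivAt (exp : 𝔸 → 𝔸) (fderiv ℝ exp A) A :=
  (exp_analytic (𝕂 := ℝ) A).differentiableAt.hasFDerivAt

theorem fderiv_exp_apply_of_commute {A H : 𝔸} (h : Commute A H) :
    fderiv ℝ exp A H = exp A * H := by
  let _ : NormedAlgebra ℚ 𝔸 := NormedAlgebra.restrictScalars ℚ ℝ 𝔸
  have hc : HasDerivAt (fun t : ℝ => A + t • H) H 0 := by
    simpa using ((hasDerivAt_id (0 : ℝ)).smul_const H).const_add A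
  have h1 : HasDerivAt (fun t : ℝ => exp (A + t • H)) (fderiv ℝ exp A H) 0 := by
    have := hasFDerivAt_exp_fderiv (A + (0 : ℝ) • H)
    simpa [Function.comp_def] using this.comp_hasDerivAt (0 : ℝ) hc
  have h2 : HasDerivAt (fun t : ℝ => exp A * exp (t • H)) (exp A * H) 0 := by
    simpa using (hasDerivAt_exp_smul_const (𝕂 := ℝ) H 0).const_mul (exp A)
  have h3 : (fun t : ℝ => exp (A + t • H)) = fun t : ℝ => exp A * exp (t • H) := by
    ext t
    exact exp_add_of_commute (h.smul_right t)
  rw [h3] at h1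
  exact h1.unique h2

/-- The derivative of `exp` along the commutator `[K, A]`: differentiate
`exp (e^{tK} A e^{-tK}) = e^{tK} (exp A) e^{-tK}` at `t = 0`. -/
theorem fderiv_exp_apply_commutator (A K : 𝔸) :
    fderiv ℝ exp A (K * A - A * K) = K * exp A - exp A * K := by
  let _ : NormedAlgebra ℚ 𝔸 := NormedAlgebra.restrictScalars ℚ ℝ 𝔸
  have hconj (B : 𝔸) : HasDerivAt (fun t : ℝ => exp (t • K) * B * exp (t • (-K)))
      (K * B - B * K) 0 := by
    have h1 := (hasDerivAt_exp_smul_const (𝕂 := ℝ) K 0).mul_const B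
    have h2 := h1.mul (hasDerivAt_exp_smul_const (𝕂 := ℝ) (-K) 0)
    simpa [sub_eq_add_neg, Pi.mul_def] using h2
  have h1 : HasDerivAt (fun t : ℝ => exp (exp (t • K) * A * exp (t • (-K))))
      (fderiv ℝ exp A (K * A - A * K)) 0 := by
    have := hasFDerivAt_exp_fderiv (exp ((0 : ℝ) • K) * A * exp ((0 : ℝ) • (-K)))
    simpa [Function.comp_def] using this.comp_hasDerivAt (0 : ℝ) (hconj A)
  have h3 : (fun t : ℝ => exp (exp (t • K) * A * exp (t • (-K))))
      = fun t : ℝ => exp (t • K) * exp A * exp (t • (-K)) := by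
    ext t
    have hu : exp (t • K) * exp (t • (-K)) = 1 := by
      rw [← exp_add_of_commute (by simp)]; simp
    have hu' : exp (t • (-K)) * exp (t • K) = 1 := by
      rw [← exp_add_of_commute (by simp)]; simp
    exact exp_units_conj ⟨_, _, hu, hu'⟩ A
  rw [h3] at h1
  exact h1.unique (hconj (exp A))

/-- The derivative of `exp` is equivariant under conjugation. -/
theorem fderiv_exp_conj (U : 𝔸ˣ) (A H : 𝔸) :
    fderiv ℝ exp (U * A * (U⁻¹ : 𝔸ˣ)) (U * H * (U⁻¹ : 𝔸ˣ))
      = U * fderiv ℝ exp A H * (U⁻¹ : 𝔸ˣ) := by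
  let _ : NormedAlgebra ℚ 𝔸 := NormedAlgebra.restrictScalars ℚ ℝ 𝔸
  have hc (B H : 𝔸) : HasDerivAt (fun t : ℝ => B + t • H) H 0 := by
    simpa using ((hasDerivAt_id (0 : ℝ)).smul_const H).const_add B
  have h1 (B H : 𝔸) : HasDerivAt (fun t : ℝ => exp (B + t • H)) (fderiv ℝ exp B H) 0 := by
    have := hasFDerivAt_exp_fderiv (B + (0 : ℝ) • H)
    simpa [Function.comp_def] using this.comp_hasDerivAt (0 : ℝ) (hc B H)
  have h2 := ((h1 A H).const_mul (U : 𝔸)).mul_const (↑U⁻¹ : 𝔸)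
  have h3 := h1 (U * A * (U⁻¹ : 𝔸ˣ)) (U * H * (U⁻¹ : 𝔸ˣ))
  have h4 : (fun t : ℝ => exp (U * A * (U⁻¹ : 𝔸ˣ) + t • (U * H * (U⁻¹ : 𝔸ˣ))))
      = fun t : ℝ => U * exp (A + t • H) * (U⁻¹ : 𝔸ˣ) := by
    ext t
    rw [← exp_units_conj]
    simp [mul_add, add_mul]
  rw [h4] at h3
  exact h3.unique h2

end BanachAlgebra

/-! ### The derivative of the matrix exponential at a symmetric matrix -/

section Matrix
open scoped Matrix.Norms.Frobenius

variable {n : Type*} [Fintype n] [DecidableEq n]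

/-- The divided difference of the exponential function at `x` and `y`, with the value `exp x` for
`x = y`. -/
noncomputable def expSlope (x y : ℝ) : ℝ :=
  if x = y then Real.exp x else (Real.exp y - Real.exp x) / (y - x)

theorem expSlope_pos (x y : ℝ) : 0 < expSlope x y := by
  unfold expSlope
  split_ifs with h
  · exact Real.exp_pos x
  · rcases lt_or_gt_of_ne h with h | h
    · exact div_pos (sub_pos.2 (Real.exp_lt_exp.2 h)) (sub_pos.2 h)
    · exact div_pos_of_neg_of_neg (sub_neg.2 (Real.exp_lt_exp.2 h)) (sub_neg.2 h)

@[simp] theorem expSlope_self (x : ℝ) : expSlope x x = Real.exp x := by simp [expSlope]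

theorem exp_diagonal_real (a : n → ℝ) :
    NormedSpace.exp (Matrix.diagonal a) = Matrix.diagonal fun i => Real.exp (a i) := by
  rw [Matrix.exp_diagonal]
  congr 1
  ext i
  rw [Pi.coe_exp, Real.exp_eq_exp_ℝ]

/-- At a diagonal matrix, the derivative of `exp` is a Schur multiplier. The entries of `H` at
positions with equal eigenvalues form a matrix `H₀` that commutes with `diagonal a`, and the other
entries form a commutator `[K, diagonal a]`. -/
theorem fderiv_exp_diagonal (a : n → ℝ) (H : Matrix n n ℝ) :
    fderiv ℝ (NormedSpace.exp : Matrix n n ℝ → Matrix n n ℝ) (Matrix.diagonal a) H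
      = Matrix.of fun i j => expSlope (a i) (a j) * H i j := by
  set H₀ : Matrix n n ℝ := Matrix.of fun i j => if a i = a j then H i j else 0
  set K : Matrix n n ℝ := Matrix.of fun i j => if a i = a j then 0 else H i j / (a j - a i)
  have hH : H = H₀ + (K * Matrix.diagonal a - Matrix.diagonal a * K) := by
    ext i j
    by_cases h : a i = a j
    · simp [H₀, K, h]
    · have : a j - a i ≠ 0 := sub_ne_zero.2 (Ne.symm h)
      simp only [H₀, K, h, Matrix.add_apply, Matrix.sub_apply, Matrix.mul_diagonal,
        Matrix.diagonal_mul, Matrix.of_apply, if_false]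
      field_simp
      ring
  have hc : Commute (Matrix.diagonal a) H₀ := by
    ext i j
    by_cases h : a i = a j <;> simp [H₀, h, mul_comm]
  have h₀ : fderiv ℝ (NormedSpace.exp : Matrix n n ℝ → Matrix n n ℝ) (Matrix.diagonal a) H₀
      = (Matrix.diagonal fun i => Real.exp (a i)) * H₀ := by
    rw [← exp_diagonal_real]
    exact fderiv_exp_apply_of_commute hc
  have h₁ : fderiv ℝ (NormedSpace.exp : Matrix n n ℝ → Matrix n n ℝ) (Matrix.diagonal a)
      (K * Matrix.diagonal a - Matrix.diagonal a * K)
      = K * (Matrix.diagonal fun i => Real.exp (a i))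
        - (Matrix.diagonal fun i => Real.exp (a i)) * K := by
    rw [← exp_diagonal_real]
    exact fderiv_exp_apply_commutator _ K
  conv_lhs => rw [hH]
  rw [map_add, h₀, h₁]
  ext i j
  by_cases h : a i = a j
  · simp [H₀, K, expSlope, h]
  · simp [H₀, K, expSlope, h]
    ring

theorem exists_orthogonal_diagonalization {A : Matrix n n ℝ} (hA : A.IsSymm) :
    ∃ (U : (Matrix n n ℝ)ˣ) (a : n → ℝ), ((U⁻¹ : (Matrix n n ℝ)ˣ) : Matrix n n ℝ) = (U.1)ᵀ ∧
      A = U.1 * Matrix.diagonal a * (U⁻¹ : (Matrix n n ℝ)ˣ) := by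
  have hH : A.IsHermitian := by
    rw [Matrix.IsHermitian, Matrix.conjTranspose_eq_transpose_of_trivial]; exact hA
  refine ⟨Unitary.toUnits hH.eigenvectorUnitary, hH.eigenvalues, ?_, ?_⟩
  · change star (hH.eigenvectorUnitary : Matrix n n ℝ) = _
    rw [Matrix.star_eq_conjTranspose, Matrix.conjTranspose_eq_transpose_of_trivial]
    rfl
  · conv_lhs => rw [hH.spectral_theorem]
    rw [Unitary.conjStarAlgAut_apply]
    rfl

/-- In an eigenbasis of the symmetric matrix `A`, the derivative of `exp` at `A` multiplies the
entries of `H` by divided differences of `exp`. -/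
theorem exists_fderiv_exp_eq_conj {A : Matrix n n ℝ} (hA : A.IsSymm) :
    ∃ (U : (Matrix n n ℝ)ˣ) (a : n → ℝ), ((U⁻¹ : (Matrix n n ℝ)ˣ) : Matrix n n ℝ) = (U.1)ᵀ ∧
      NormedSpace.exp A = U.1 * (Matrix.diagonal fun i => Real.exp (a i))
        * (U⁻¹ : (Matrix n n ℝ)ˣ) ∧ A = U.1 * Matrix.diagonal a * (U⁻¹ : (Matrix n n ℝ)ˣ) ∧
      ∀ H, fderiv ℝ (NormedSpace.exp : Matrix n n ℝ → Matrix n n ℝ) A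
          (U.1 * H * (U⁻¹ : (Matrix n n ℝ)ˣ))
        = U.1 * (Matrix.of fun i j => expSlope (a i) (a j) * H i j)
          * (U⁻¹ : (Matrix n n ℝ)ˣ) := by
  obtain ⟨U, a, hU, hUA⟩ := exists_orthogonal_diagonalization hA
  refine ⟨U, a, hU, ?_, hUA, fun H => ?_⟩
  · rw [hUA, Matrix.exp_units_conj, exp_diagonal_real]
  · rw [hUA, ← fderiv_exp_diagonal]
    exact fderiv_exp_conj U (Matrix.diagonal a) H

theorem trace_units_conj (U : (Matrix n n ℝ)ˣ) (M : Matrix n n ℝ) :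
    (U.1 * M * (U⁻¹ : (Matrix n n ℝ)ˣ)).trace = M.trace := by
  rw [Matrix.trace_mul_comm, ← mul_assoc]
  simp

theorem eq_units_conj (U : (Matrix n n ℝ)ˣ) (M : Matrix n n ℝ) :
    M = U.1 * ((U⁻¹ : (Matrix n n ℝ)ˣ) * M * U) * (U⁻¹ : (Matrix n n ℝ)ˣ) := by
  simp [mul_assoc]

theorem det_exp_of_isSymm {A : Matrix n n ℝ} (hA : A.IsSymm) :
    (NormedSpace.exp A).det = Real.exp A.trace := by
  obtain ⟨U, a, -, hE, hUA, -⟩ := exists_fderiv_exp_eq_conj hA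
  rw [hE, hUA, trace_units_conj, Matrix.det_units_conj, Matrix.det_diagonal, ← Real.exp_sum,
    Matrix.trace_diagonal]

theorem trace_exp_pos [Nonempty n] {A : Matrix n n ℝ} (hA : A.IsSymm) :
    0 < (NormedSpace.exp A).trace := by
  obtain ⟨U, a, -, hE, -, -⟩ := exists_fderiv_exp_eq_conj hA
  rw [hE, trace_units_conj, Matrix.trace_diagonal]
  positivity

theorem trace_fderiv_exp {A : Matrix n n ℝ} (hA : A.IsSymm) (H : Matrix n n ℝ) :
    (fderiv ℝ (NormedSpace.exp : Matrix n n ℝ → Matrix n n ℝ) A H).trace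
      = (NormedSpace.exp A * H).trace := by
  obtain ⟨U, a, -, hE, -, hL⟩ := exists_fderiv_exp_eq_conj hA
  generalize hH' : (U⁻¹ : (Matrix n n ℝ)ˣ) * H * U.1 = H'
  have hH : H = U.1 * H' * (U⁻¹ : (Matrix n n ℝ)ˣ) := by rw [← hH']; exact eq_units_conj U H
  have hm : NormedSpace.exp A * H = U.1 * ((Matrix.diagonal fun i => Real.exp (a i)) * H')
      * (U⁻¹ : (Matrix n n ℝ)ˣ) := by
    rw [hE, hH]
    simp [mul_assoc]
  rw [hm, hH, hL, trace_units_conj, trace_units_conj]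
  simp [Matrix.trace]

/-- The derivative of `exp` at a symmetric matrix is positive definite for the Frobenius inner
product. -/
theorem trace_fderiv_exp_mul_transpose_pos {A H : Matrix n n ℝ} (hA : A.IsSymm) (hH0 : H ≠ 0) :
    0 < (fderiv ℝ (NormedSpace.exp : Matrix n n ℝ → Matrix n n ℝ) A H * Hᵀ).trace := by
  obtain ⟨U, a, hU, hE, -, hL⟩ := exists_fderiv_exp_eq_conj hA
  generalize hH' : (U⁻¹ : (Matrix n n ℝ)ˣ) * H * U.1 = H'
  have hH : H = U.1 * H' * (U⁻¹ : (Matrix n n ℝ)ˣ) := by rw [← hH']; exact eq_units_conj U H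
  have hT : Hᵀ = U.1 * H'ᵀ * (U⁻¹ : (Matrix n n ℝ)ˣ) := by
    rw [hH, hU]
    simp [mul_assoc]
  have h' : H' ≠ 0 := by
    rintro rfl
    exact hH0 (by simp [hH])
  rw [hT, hH, hL]
  have hm (M N : Matrix n n ℝ) : U.1 * M * (U⁻¹ : (Matrix n n ℝ)ˣ)
      * (U.1 * N * (U⁻¹ : (Matrix n n ℝ)ˣ)) = U.1 * (M * N) * (U⁻¹ : (Matrix n n ℝ)ˣ) := by
    simp [mul_assoc]
  rw [hm, trace_units_conj]
  have hs : (Matrix.of (fun i j => expSlope (a i) (a j) * H' i j) * H'ᵀ).trace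
      = ∑ i, ∑ j, expSlope (a i) (a j) * H' i j ^ 2 := by
    simp [Matrix.trace, Matrix.mul_apply, pow_two, mul_assoc]
  rw [hs]
  obtain ⟨i, j, hij⟩ : ∃ i j, H' i j ≠ 0 := by
    by_contra! h
    exact h' (by ext i j; simpa using h i j)
  have hnn (i j : n) : 0 ≤ expSlope (a i) (a j) * H' i j ^ 2 :=
    mul_nonneg (expSlope_pos _ _).le (sq_nonneg _)
  refine Finset.sum_pos' (fun i _ => Finset.sum_nonneg fun j _ => hnn i j)
    ⟨i, Finset.mem_univ i, ?_⟩
  refine Finset.sum_pos' (fun j _ => hnn i j) ⟨j, Finset.mem_univ j, ?_⟩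
  exact mul_pos (expSlope_pos _ _) (by positivity)

/-- The Cauchy–Schwarz inequality for the quadratic form of the derivative of `exp`, applied to
`H` and the identity. -/
theorem sq_trace_exp_mul_le [Nonempty n] {A : Matrix n n ℝ} (hA : A.IsSymm) (H : Matrix n n ℝ) :
    (NormedSpace.exp A * H).trace ^ 2
      ≤ (fderiv ℝ (NormedSpace.exp : Matrix n n ℝ → Matrix n n ℝ) A H * Hᵀ).trace
        * (NormedSpace.exp A).trace := by
  have hs := trace_exp_pos hA
  set m := (NormedSpace.exp A * H).trace with hm
  set s := (NormedSpace.exp A).trace with hs'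
  set r := m / s with hr
  set L := fderiv ℝ (NormedSpace.exp : Matrix n n ℝ → Matrix n n ℝ) A with hLd
  have h1 : L 1 = NormedSpace.exp A := by
    have : L 1 = NormedSpace.exp A * 1 := fderiv_exp_apply_of_commute (Commute.one_right A)
    rw [this, mul_one]
  have hmT : (NormedSpace.exp A * Hᵀ).trace = m := by
    rw [← Matrix.trace_transpose, Matrix.transpose_mul, Matrix.transpose_transpose,
      (Matrix.IsSymm.exp hA).eq, Matrix.trace_mul_comm]
  have hLt : (L H).trace = m := trace_fderiv_exp hA H
  -- `H - r • 1` is the component of `H` orthogonal to the identity for the form of `L`.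
  have key : 0 ≤ (L (H - r • 1) * (H - r • (1 : Matrix n n ℝ))ᵀ).trace := by
    by_cases h0 : H - r • (1 : Matrix n n ℝ) = 0
    · rw [h0]; simp
    · exact (trace_fderiv_exp_mul_transpose_pos hA h0).le
  have hexp : (L (H - r • 1) * (H - r • (1 : Matrix n n ℝ))ᵀ).trace
      = (L H * Hᵀ).trace - r * m - r * m + r * r * s := by
    rw [map_sub, map_smul, h1]
    simp only [Matrix.transpose_sub, Matrix.transpose_smul, Matrix.transpose_one, sub_mul, mul_sub,
      Matrix.trace_sub, Matrix.smul_mul, Matrix.mul_smul, Matrix.trace_smul, mul_one, hLt, hmT,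
      smul_eq_mul, ← hs']
    ring
  have hrs : r * s = m := div_mul_cancel₀ _ hs.ne'
  rw [hexp] at key
  have : 0 ≤ ((L H * Hᵀ).trace - r * m - r * m + r * r * s) * s := mul_nonneg key hs.le
  have h2 : ((L H * Hᵀ).trace - r * m - r * m + r * r * s) * s
      = (L H * Hᵀ).trace * s - m ^ 2 := by
    rw [← hrs]; ring
  linarith

end Matrix

/-! ### The left Cauchy–Green tensor as a function of the Hencky strain -/

section SymmetricTensors
open scoped Matrix.Norms.Frobenius

theorem frobNorm_eq_norm (F : Mat) : frobNorm F = ‖F‖ := by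
  rw [Matrix.frobenius_norm_def, frobNorm, contract_self, Real.sqrt_eq_rpow]
  simp

/-- The inclusion `Sym(3) → ℝ³ˣ³` as a continuous linear map. -/
noncomputable def toMatCLM : Sym3 →L[ℝ] Mat := LinearMap.toContinuousLinearMap Sym3.toMat

/-- The symmetric part of a tensor, as a linear map onto `Sym(3)`. -/
noncomputable def symPartLinear : Mat →ₗ[ℝ] Sym3 where
  toFun M := (⟨(1 / 2 : ℝ) • (M + Mᵀ), by
    change (((1 / 2 : ℝ) • (M + Mᵀ))ᵀ) = _
    simp [add_comm]⟩ : symSubmodule)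
  map_add' M N := by
    apply Sym3.toMat_injective
    change (1 / 2 : ℝ) • (M + N + (M + N)ᵀ) = (1 / 2 : ℝ) • (M + Mᵀ) + (1 / 2 : ℝ) • (N + Nᵀ)
    rw [Matrix.transpose_add, ← smul_add]
    congr 1
    abel
  map_smul' c M := by
    apply Sym3.toMat_injective
    change (1 / 2 : ℝ) • (c • M + (c • M)ᵀ) = c • (1 / 2 : ℝ) • (M + Mᵀ)
    rw [Matrix.transpose_smul, ← smul_add, smul_comm]

/-- The symmetric part, as a continuous linear map. -/
noncomputable def symPart : Mat →L[ℝ] Sym3 := LinearMap.toContinuousLinearMap symPartLinear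

theorem inner_symPart (M : Mat) (H : Sym3) : ⟪symPart M, H⟫ = (M * H.toMat).trace := by
  rw [Sym3.inner_def]
  change ((1 / 2 : ℝ) • (M + Mᵀ) * H.toMatᵀ).trace = _
  have h : (Mᵀ * H.toMat).trace = (M * H.toMat).trace := by
    rw [← Matrix.trace_transpose, Matrix.transpose_mul, Matrix.transpose_transpose, H.isSymm.eq,
      Matrix.trace_mul_comm]
  rw [H.isSymm.eq, Matrix.smul_mul, Matrix.trace_smul, add_mul, Matrix.trace_add, h, smul_eq_mul]
  ring

theorem isSymm_two_smul (X : Sym3) : ((2 : ℝ) • X.toMat).IsSymm :=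
  Matrix.IsSymm.smul X.isSymm 2

/-- The left Cauchy–Green tensor `B = V² = exp(2 log V)` as a function of the Hencky strain. -/
noncomputable def leftCauchyGreen (X : Sym3) : Mat := NormedSpace.exp ((2 : ℝ) • X.toMat)

/-- The derivative `H ↦ 2 D exp(2X).H` of `leftCauchyGreen` at `X`. -/
noncomputable def leftCauchyGreenDeriv (X : Sym3) : Sym3 →L[ℝ] Mat :=
  (fderiv ℝ (NormedSpace.exp : Mat → Mat) ((2 : ℝ) • X.toMat)).comp ((2 : ℝ) • toMatCLM)

theorem hasFDerivAt_leftCauchyGreen (X : Sym3) :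
    HasFDerivAt leftCauchyGreen (leftCauchyGreenDeriv X) X := by
  have h1 : HasFDerivAt (fun X : Sym3 => (2 : ℝ) • X.toMat) ((2 : ℝ) • toMatCLM) X :=
    ((2 : ℝ) • toMatCLM).hasFDerivAt
  have h2 := hasFDerivAt_exp_fderiv ((2 : ℝ) • X.toMat)
  exact h2.comp X h1

theorem leftCauchyGreenDeriv_apply (X H : Sym3) : leftCauchyGreenDeriv X H
    = (2 : ℝ) • fderiv ℝ (NormedSpace.exp : Mat → Mat) ((2 : ℝ) • X.toMat) H.toMat := by
  rw [← map_smul]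
  rfl

/-- `‖V‖² = tr B` as a function of the Hencky strain. -/
noncomputable def stretchSq (X : Sym3) : ℝ := (leftCauchyGreen X).trace

/-- The trace `tr H` as a continuous linear functional on `Sym(3)`. -/
noncomputable def traceCLM : Sym3 →L[ℝ] ℝ :=
  LinearMap.toContinuousLinearMap ((Matrix.traceLinearMap (Fin 3) ℝ ℝ).comp Sym3.toMat)

@[simp] theorem traceCLM_apply (X : Sym3) : traceCLM X = X.toMat.trace := rfl

theorem inner_symPart_one (H : Sym3) : ⟪symPart 1, H⟫ = traceCLM H := by
  rw [inner_symPart, one_mul, traceCLM_apply]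

theorem stretchSq_pos (X : Sym3) : 0 < stretchSq X := trace_exp_pos (isSymm_two_smul X)

/-- The derivative `H ↦ ⟨B, H⟩` of half of `stretchSq`. -/
noncomputable def halfStretchSqDeriv (X : Sym3) : Sym3 →L[ℝ] ℝ :=
  (InnerProductSpace.toDual ℝ Sym3 (symPart (leftCauchyGreen X)) : Sym3 →L[ℝ] ℝ)

theorem halfStretchSqDeriv_apply (X H : Sym3) :
    halfStretchSqDeriv X H = ⟪symPart (leftCauchyGreen X), H⟫ := rfl

theorem hasFDerivAt_stretchSq (X : Sym3) :
    HasFDerivAt stretchSq ((2 : ℝ) • halfStretchSqDeriv X) X := by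
  have h := (LinearMap.toContinuousLinearMap (Matrix.traceLinearMap (Fin 3) ℝ ℝ)).hasFDerivAt.comp
    X (hasFDerivAt_leftCauchyGreen X)
  refine (h.congr_fderiv ?_ : HasFDerivAt stretchSq _ X)
  ext H
  change (leftCauchyGreenDeriv X H).trace = 2 * halfStretchSqDeriv X H
  rw [leftCauchyGreenDeriv_apply, Matrix.trace_smul, trace_fderiv_exp (isSymm_two_smul X),
    halfStretchSqDeriv_apply, inner_symPart]
  rfl

/-- The quadratic form `⟨D exp(2X).H, H⟩`. -/
noncomputable def expQuad (X H : Sym3) : ℝ :=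
  (fderiv ℝ (NormedSpace.exp : Mat → Mat) ((2 : ℝ) • X.toMat) H.toMat * H.toMat).trace

theorem inner_symPart_leftCauchyGreenDeriv (X H : Sym3) :
    ⟪symPart (leftCauchyGreenDeriv X H), H⟫ = 2 * expQuad X H := by
  rw [inner_symPart, leftCauchyGreenDeriv_apply, Matrix.smul_mul, Matrix.trace_smul, expQuad,
    smul_eq_mul]

theorem expQuad_pos (X : Sym3) {H : Sym3} (hH : H ≠ 0) : 0 < expQuad X H := by
  have h0 : H.toMat ≠ 0 := fun h => hH (Sym3.toMat_injective (by rw [h, map_zero]))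
  have := trace_fderiv_exp_mul_transpose_pos (isSymm_two_smul X) h0
  rwa [H.isSymm.eq] at this

theorem expQuad_nonneg (X H : Sym3) : 0 ≤ expQuad X H := by
  rcases eq_or_ne H 0 with rfl | h
  · simp [expQuad]
  · exact (expQuad_pos X h).le

/-- The Cauchy–Schwarz inequality `⟨B, H⟩² ≤ ⟨D exp(2X).H, H⟩ tr B`. -/
theorem sq_halfStretchSqDeriv_le (X H : Sym3) :
    halfStretchSqDeriv X H ^ 2 ≤ expQuad X H * stretchSq X := by
  have := sq_trace_exp_mul_le (isSymm_two_smul X) H.toMat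
  rw [H.isSymm.eq] at this
  rw [halfStretchSqDeriv_apply, inner_symPart]
  exact this

theorem det_stretch (X : Sym3) : (stretch X).1.det = Real.exp (traceCLM X) :=
  det_exp_of_isSymm X.isSymm

theorem frobNorm_stretch_rpow (X : Sym3) (α : ℝ) :
    frobNorm (stretch X).1 ^ α = stretchSq X ^ (α / 2) := by
  have h : contract (stretch X).1 (stretch X).1 = stretchSq X := by
    have hT : (stretch X).1ᵀ = (stretch X).1 := Matrix.IsSymm.exp X.isSymm
    rw [contract, hT, stretchSq, leftCauchyGreen, two_smul,
      Matrix.exp_add_of_commute _ _ (Commute.refl _)]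
    rfl
  rw [frobNorm, h, Real.sqrt_eq_rpow, ← Real.rpow_mul (stretchSq_pos X).le]
  congr 1
  ring

theorem continuous_stretchSq : Continuous stretchSq :=
  continuous_iff_continuousAt.2 fun X => (hasFDerivAt_stretchSq X).continuousAt

theorem hasDerivAt_line (X H : Sym3) (t : ℝ) : HasDerivAt (fun t : ℝ => X + t • H) H t := by
  simpa using ((hasDerivAt_id t).smul_const H).const_add X

/-- Along a line the second derivative of `tr exp(2X)` is `4 ⟨D exp(2X).H, H⟩ ≥ 0`. -/
theorem convexOn_stretchSq : ConvexOn ℝ Set.univ stretchSq := by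
  refine ⟨convex_univ, fun X _ Y _ a b ha hb hab => ?_⟩
  have h1 (t : ℝ) : HasDerivAt (fun t : ℝ => stretchSq (X + t • (Y - X)))
      (2 * halfStretchSqDeriv (X + t • (Y - X)) (Y - X)) t :=
    (hasFDerivAt_stretchSq _).comp_hasDerivAt t (hasDerivAt_line X (Y - X) t)
  have h2 (t : ℝ) : HasDerivAt (fun t : ℝ => 2 * halfStretchSqDeriv (X + t • (Y - X)) (Y - X))
      (2 * (2 * expQuad (X + t • (Y - X)) (Y - X))) t := by
    have hE := (hasFDerivAt_leftCauchyGreen (X + t • (Y - X))).comp_hasDerivAt t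
      (hasDerivAt_line X (Y - X) t)
    have hP := symPart.hasFDerivAt.comp_hasDerivAt t hE
    have hI := (hP.inner ℝ (hasDerivAt_const t (Y - X))).const_mul 2
    simp only [inner_zero_right, zero_add] at hI
    exact hI.congr_deriv
      (congrArg (2 * ·) (inner_symPart_leftCauchyGreenDeriv (X + t • (Y - X)) (Y - X)))
  have hc : ConvexOn ℝ Set.univ (fun t : ℝ => stretchSq (X + t • (Y - X))) := by
    refine convexOn_of_hasDerivWithinAt2_nonneg convex_univ
      (continuous_iff_continuousAt.2 fun t => (h1 t).continuousAt).continuousOn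
      (fun t _ => (h1 t).hasDerivWithinAt) (fun t _ => (h2 t).hasDerivWithinAt) fun t _ => ?_
    have := expQuad_nonneg (X + t • (Y - X)) (Y - X)
    positivity
  have := hc.2 (Set.mem_univ 0) (Set.mem_univ 1) ha hb hab
  have he : X + b • (Y - X) = a • X + b • Y := by
    obtain rfl : a = 1 - b := by linarith
    module
  simpa [he] using this

end SymmetricTensors

/-! ### Convexity of the constraint and polyconvexity of the energy -/

section Convexity
open scoped Matrix.Norms.Frobenius

theorem frobNorm_nonneg (F : Mat) : 0 ≤ frobNorm F := Real.sqrt_nonneg _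

theorem convexOn_frobNorm_rpow {α : ℝ} (hα : 1 ≤ α) :
    ConvexOn ℝ Set.univ fun F : Mat => frobNorm F ^ α := by
  refine ⟨convex_univ, fun F _ G _ a b ha hb hab => ?_⟩
  have h1 : frobNorm (a • F + b • G) ≤ a • frobNorm F + b • frobNorm G := by
    simp only [frobNorm_eq_norm]
    exact (convexOn_norm convex_univ).2 (Set.mem_univ F) (Set.mem_univ G) ha hb hab
  exact (Real.rpow_le_rpow (frobNorm_nonneg _) h1 (by linarith)).trans
    ((convexOn_rpow hα).2 (frobNorm_nonneg F) (frobNorm_nonneg G) ha hb hab)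

theorem convex_setOf_frobNorm_rpow_lt {α : ℝ} (hα : 1 ≤ α) (β : ℝ) :
    Convex ℝ {F : Mat | frobNorm F ^ α < β} := by
  simpa using (convexOn_frobNorm_rpow hα).convex_lt β

theorem mem_admissible_iff {α β γ κ : ℝ} {X : Sym3} :
    X ∈ admissible (chainEnergy α β γ κ) ↔ stretchSq X ^ (α / 2) < β := by
  rw [← frobNorm_stretch_rpow]
  simp only [admissible, chainEnergy, Set.mem_ofPred_eq]
  split_ifs with h
  · exact iff_of_true (EReal.coe_lt_top _) h
  · exact iff_of_false (lt_irrefl _) h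

/-- The admissible strains form a sublevel set of the convex function `X ↦ tr exp(2X)`. -/
theorem convex_admissible {α : ℝ} (hα : 1 ≤ α) (β γ κ : ℝ) :
    Convex ℝ (admissible (chainEnergy α β γ κ)) := by
  intro X hX Y hY a b ha hb hab
  rw [mem_admissible_iff] at *
  have h1 := convexOn_stretchSq.2 (Set.mem_univ X) (Set.mem_univ Y) ha hb hab
  have h2 : a • stretchSq X + b • stretchSq Y ≤ max (stretchSq X) (stretchSq Y) := by
    obtain rfl : a = 1 - b := by linarith
    simp only [smul_eq_mul]
    nlinarith [le_max_left (stretchSq X) (stretchSq Y), le_max_right (stretchSq X) (stretchSq Y)]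
  refine (Real.rpow_le_rpow (stretchSq_pos _).le (h1.trans h2) (by linarith)).trans_lt ?_
  rcases max_cases (stretchSq X) (stretchSq Y) with h | h <;> rw [h.1] <;> assumption

/-- The formula for the energy, read with `‖F‖` and `det F` as independent variables, is convex:
`-log` is convex and decreasing, and `‖F‖^α` is convex. -/
theorem polyconvex_chainEnergy {α γ : ℝ} (hα : 1 ≤ α) (hγ : 0 ≤ γ) (β κ : ℝ) :
    Polyconvex (chainEnergy α β γ κ) := by
  classical
  set c : ℝ := α * ((3 : ℝ) ^ (α / 2 - 1) / (β - (3 : ℝ) ^ (α / 2)))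
  set w : Mat × Mat × ℝ → ℝ := fun p => -Real.log (β - frobNorm p.1 ^ α) - γ * Real.log p.2.2
    + (γ - c) * p.2.2 + κ with hw
  refine ⟨fun p => if frobNorm p.1 ^ α < β then (w p : EReal) else ⊤,
    ⟨?_, ?_, ?_⟩, fun F => rfl⟩
  · intro p hp q hq a b ha hb hab
    exact (convex_Ioi (0 : ℝ)) hp hq ha hb hab
  · intro p _
    dsimp only
    split_ifs <;> simp
  · intro p hp q hq a b ha hb hab
    dsimp only
    by_cases hpβ : frobNorm p.1 ^ α < β
    · by_cases hqβ : frobNorm q.1 ^ α < β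
      · have hm : frobNorm (a • p + b • q).1 ^ α < β :=
          convex_setOf_frobNorm_rpow_lt hα β hpβ hqβ ha.le hb.le hab
        rw [if_pos hpβ, if_pos hqβ, if_pos hm]
        norm_cast
        have hlog := strictConcaveOn_log_Ioi.concaveOn
        have h1 : a * Real.log (β - frobNorm p.1 ^ α) + b * Real.log (β - frobNorm q.1 ^ α)
            ≤ Real.log (β - frobNorm (a • p + b • q).1 ^ α) := by
          have hx : β - frobNorm p.1 ^ α ∈ Set.Ioi (0 : ℝ) := sub_pos.2 hpβ
          have hy : β - frobNorm q.1 ^ α ∈ Set.Ioi (0 : ℝ) := sub_pos.2 hqβ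
          have hcv := (convexOn_frobNorm_rpow hα).2 (Set.mem_univ p.1) (Set.mem_univ q.1)
            ha.le hb.le hab
          simp only [smul_eq_mul] at hcv
          refine (hlog.2 hx hy ha.le hb.le hab).trans (Real.log_le_log ?_ ?_)
          · exact (convex_Ioi (0 : ℝ)) hx hy ha.le hb.le hab
          · change _ ≤ β - frobNorm (a • p.1 + b • q.1) ^ α
            simp only [smul_eq_mul]
            obtain rfl : a = 1 - b := by linarith
            linarith
        have h2 : a * Real.log p.2.2 + b * Real.log q.2.2 ≤ Real.log (a * p.2.2 + b * q.2.2) :=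
          hlog.2 hp hq ha.le hb.le hab
        have h3 := mul_le_mul_of_nonneg_left h2 hγ
        have h4 : (a • p + b • q).2.2 = a * p.2.2 + b * q.2.2 := rfl
        simp only [hw, h4]
        obtain rfl : a = 1 - b := by linarith
        linarith
      · rw [if_neg hqβ, EReal.coe_mul_top_of_pos hb, if_pos hpβ, ← EReal.coe_mul,
          EReal.coe_add_top]
        exact le_top
    · rw [if_neg hpβ, EReal.coe_mul_top_of_pos ha]
      refine le_top.trans_eq (Eq.symm ?_)
      by_cases hqβ : frobNorm q.1 ^ α < β
      · rw [if_pos hqβ, ← EReal.coe_mul, EReal.top_add_coe]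
      · rw [if_neg hqβ, EReal.coe_mul_top_of_pos hb, EReal.top_add_top]

end Convexity

/-! ### The Cauchy stress -/

section Stress
open scoped Matrix.Norms.Frobenius Topology

/-- The coefficient `h(s) = α s^{α/2-1} / (β - s^{α/2})` of `B` in the Kirchhoff stress. -/
noncomputable def stressCoeff (α β s : ℝ) : ℝ := α * s ^ (α / 2 - 1) / (β - s ^ (α / 2))

/-- The derivative of `stressCoeff` with respect to `s`. -/
noncomputable def stressCoeffDeriv (α β s : ℝ) : ℝ :=
  stressCoeff α β s * ((α / 2 - 1) / s + stressCoeff α β s / 2)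

variable {α β γ κ : ℝ}

theorem stressCoeff_pos (hα : 0 < α) {s : ℝ} (hs : 0 < s) (hβ : s ^ (α / 2) < β) :
    0 < stressCoeff α β s :=
  div_pos (mul_pos hα (Real.rpow_pos_of_pos hs _)) (sub_pos.2 hβ)

theorem hasDerivAt_neg_log_sub_rpow {s : ℝ} (hs : 0 < s) (hβ : s ^ (α / 2) < β) :
    HasDerivAt (fun s : ℝ => -Real.log (β - s ^ (α / 2))) (stressCoeff α β s / 2) s := by
  have h1 := ((Real.hasDerivAt_rpow_const (p := α / 2) (Or.inl hs.ne')).const_sub β).log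
    (sub_pos.2 hβ).ne'
  refine h1.neg.congr_deriv ?_
  rw [stressCoeff]
  have := (sub_pos.2 hβ).ne'
  field_simp

theorem hasDerivAt_stressCoeff {s : ℝ} (hs : 0 < s) (hβ : s ^ (α / 2) < β) :
    HasDerivAt (stressCoeff α β) (stressCoeffDeriv α β s) s := by
  have h1 := (Real.hasDerivAt_rpow_const (p := α / 2 - 1) (Or.inl hs.ne')).const_mul α
  have h2 := (Real.hasDerivAt_rpow_const (p := α / 2) (Or.inl hs.ne')).const_sub β
  have h0 := (sub_pos.2 hβ).ne'
  refine (h1.div h2 h0).congr_deriv ?_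
  rw [stressCoeffDeriv, stressCoeff, Real.rpow_sub_one hs.ne' (α / 2 - 1)]
  field_simp
  ring

/-- The constant `α 3^{α/2-1} / (β - 3^{α/2})`, for which the reference state is stress-free. -/
noncomputable def referencePressure (α β : ℝ) : ℝ :=
  α * ((3 : ℝ) ^ (α / 2 - 1) / (β - (3 : ℝ) ^ (α / 2)))

/-- The set of admissible Hencky strains is open. -/
theorem eventually_mem_admissible (hα : 0 ≤ α) {X : Sym3}
    (hX : X ∈ admissible (chainEnergy α β γ κ)) :
    ∀ᶠ Y in 𝓝 X, Y ∈ admissible (chainEnergy α β γ κ) := by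
  simp only [mem_admissible_iff] at *
  exact (continuous_stretchSq.rpow_const fun _ => Or.inr (by linarith)).continuousAt.eventually_lt
    continuousAt_const hX

/-- The energy on the admissible Hencky strains. -/
theorem energyHat_eq {X : Sym3} (hX : X ∈ admissible (chainEnergy α β γ κ)) :
    energyHat (chainEnergy α β γ κ) X = -Real.log (β - stretchSq X ^ (α / 2)) - γ * traceCLM X
      + (γ - referencePressure α β) * Real.exp (traceCLM X) + κ := by
  rw [mem_admissible_iff] at hX
  rw [energyHat, chainEnergy, frobNorm_stretch_rpow, if_pos hX, EReal.toReal_coe, det_stretch,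
    Real.log_exp, referencePressure]

/-- The gradient of the energy, which is the Kirchhoff stress, on the admissible Hencky strains. -/
theorem hasGradientAt_energyHat (hα : 0 ≤ α) {X : Sym3}
    (hX : X ∈ admissible (chainEnergy α β γ κ)) :
    HasGradientAt (energyHat (chainEnergy α β γ κ))
      (stressCoeff α β (stretchSq X) • symPart (leftCauchyGreen X)
        + (-γ + (γ - referencePressure α β) * Real.exp (traceCLM X)) • symPart 1) X := by
  have hX' := mem_admissible_iff.1 hX
  have h1 := (hasDerivAt_neg_log_sub_rpow (stretchSq_pos X) hX').comp_hasFDerivAt X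
    (hasFDerivAt_stretchSq X)
  have ht : HasFDerivAt (fun X : Sym3 => traceCLM X) traceCLM X := traceCLM.hasFDerivAt
  have h2 := ((h1.sub (ht.const_mul γ)).add
    (ht.exp.const_mul (γ - referencePressure α β))).add_const κ
  rw [hasGradientAt_iff_hasFDerivAt]
  refine (h2.congr_fderiv ?_).congr_of_eventuallyEq
    ((eventually_mem_admissible hα hX).mono fun Y hY => energyHat_eq hY)
  ext H
  simp only [map_add, map_smul, add_apply, sub_apply,
    smul_apply, smul_eq_mul, InnerProductSpace.toDual_apply_apply,
    inner_symPart_one, halfStretchSqDeriv_apply]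
  ring

/-- The Cauchy stress on the admissible Hencky strains. -/
theorem cauchyStress_eq (hα : 0 ≤ α) {X : Sym3} (hX : X ∈ admissible (chainEnergy α β γ κ)) :
    cauchyStress (chainEnergy α β γ κ) X
      = (Real.exp (-traceCLM X) * stressCoeff α β (stretchSq X)) • symPart (leftCauchyGreen X)
        + (-γ * Real.exp (-traceCLM X) + (γ - referencePressure α β)) • symPart 1 := by
  rw [cauchyStress, (hasGradientAt_energyHat hα hX).gradient, det_stretch, Real.exp_neg, smul_add,
    smul_smul, smul_smul]
  have := (Real.exp_pos (traceCLM X)).ne'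
  congr 2
  field_simp

/-- The quadratic form of the derivative of the Cauchy stress, in terms of `tr H`, `⟨B, H⟩` and
`⟨D exp(2X).H, H⟩`. -/
theorem exists_hasFDerivAt_cauchyStress (hα : 0 ≤ α) {X : Sym3}
    (hX : X ∈ admissible (chainEnergy α β γ κ)) :
    ∃ D : Sym3 →L[ℝ] Sym3, HasFDerivAt (cauchyStress (chainEnergy α β γ κ)) D X ∧
      ∀ H, ⟪D H, H⟫ = Real.exp (-traceCLM X) * (γ * traceCLM H ^ 2
        - stressCoeff α β (stretchSq X) * traceCLM H * halfStretchSqDeriv X H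
        + 2 * stressCoeffDeriv α β (stretchSq X) * halfStretchSqDeriv X H ^ 2
        + 2 * stressCoeff α β (stretchSq X) * expQuad X H) := by
  have hX' := mem_admissible_iff.1 hX
  have ht : HasFDerivAt (fun X : Sym3 => Real.exp (-traceCLM X))
      (Real.exp (-traceCLM X) • -traceCLM) X := traceCLM.hasFDerivAt.neg.exp
  have hh := (hasDerivAt_stressCoeff (stretchSq_pos X) hX').comp_hasFDerivAt X
    (hasFDerivAt_stretchSq X)
  have hB : HasFDerivAt (fun X : Sym3 => symPart (leftCauchyGreen X))
      (symPart.comp (leftCauchyGreenDeriv X)) X :=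
    symPart.hasFDerivAt.comp X (hasFDerivAt_leftCauchyGreen X)
  have h := ((ht.mul hh).smul hB).add
    (((ht.const_mul (-γ)).add_const (γ - referencePressure α β)).smul_const (symPart 1))
  refine ⟨_, h.congr_of_eventuallyEq
    ((eventually_mem_admissible hα hX).mono fun Y hY => cauchyStress_eq hα hY), fun H => ?_⟩
  simp only [add_apply, smul_apply, smul_eq_mul,
    ContinuousLinearMap.smulRight_apply, ContinuousLinearMap.comp_apply,
    neg_apply, inner_add_left, real_inner_smul_left, inner_symPart_one,
    ← halfStretchSqDeriv_apply, inner_symPart_leftCauchyGreenDeriv, Function.comp_apply,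
    Pi.mul_apply]
  ring

/-- After bounding `l` below by `m² / s` and `γ` by `1/4`, the form is at least
`(t/2 - h m)² + h α m² / s`; if `m` vanishes, the term `2 h l` is positive by itself. -/
theorem quadratic_form_pos (hα : 0 < α) (hγ : 1 / 4 ≤ γ) {s t m h l : ℝ} (hs : 0 < s) (hh : 0 < h)
    (hl : 0 < l) (hm : m ^ 2 ≤ l * s) :
    0 < γ * t ^ 2 - h * t * m + 2 * (h * ((α / 2 - 1) / s + h / 2)) * m ^ 2 + 2 * h * l := by
  have h1 : 2 * (h * ((α / 2 - 1) / s + h / 2)) * m ^ 2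
      = h * α * m ^ 2 / s - 2 * h * (m ^ 2 / s) + h ^ 2 * m ^ 2 := by
    field_simp
  have h2 : m ^ 2 / s ≤ l := (div_le_iff₀ hs).2 hm
  have h3 : 1 / 4 * t ^ 2 ≤ γ * t ^ 2 := mul_le_mul_of_nonneg_right hγ (sq_nonneg t)
  have h5 : 0 ≤ (t / 2 - h * m) ^ 2 := sq_nonneg _
  rw [h1]
  rcases eq_or_ne m 0 with rfl | hm0
  · simp only [ne_eq, OfNat.ofNat_ne_zero, not_false_eq_true, zero_pow, mul_zero, zero_div]
    nlinarith [mul_pos hh hl, sq_nonneg t]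
  · have h4 : 0 < h * α * m ^ 2 / s := by positivity
    nlinarith [mul_le_mul_of_nonneg_left h2 hh.le]

theorem exists_hasFDerivAt_cauchyStress_pos (hα : 0 < α) (hγ : 1 / 4 ≤ γ) {X : Sym3}
    (hX : X ∈ admissible (chainEnergy α β γ κ)) :
    ∃ D : Sym3 →L[ℝ] Sym3, HasFDerivAt (cauchyStress (chainEnergy α β γ κ)) D X ∧
      ∀ H, H ≠ 0 → 0 < ⟪D H, H⟫ := by
  obtain ⟨D, hD, hDH⟩ := exists_hasFDerivAt_cauchyStress hα.le hX
  refine ⟨D, hD, fun H hH => ?_⟩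
  rw [hDH]
  have hs := stretchSq_pos X
  exact mul_pos (Real.exp_pos _) (quadratic_form_pos hα hγ hs
    (stressCoeff_pos hα hs (mem_admissible_iff.1 hX)) (expQuad_pos X hH)
    (sq_halfStretchSqDeriv_le X H))

/-- On a convex set, a vector field with positive definite derivative is strictly monotone. -/
theorem inner_sub_pos_of_hasFDerivAt_pos {E : Type*} [NormedAddCommGroup E]
    [InnerProductSpace ℝ E] {C : Set E} (hC : Convex ℝ C) {f : E → E} {f' : E → E →L[ℝ] E}
    (hf : ∀ x ∈ C, HasFDerivAt f (f' x) x) (hpos : ∀ x ∈ C, ∀ v, v ≠ 0 → 0 < ⟪f' x v, v⟫)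
    {x y : E} (hx : x ∈ C) (hy : y ∈ C) (hxy : x ≠ y) : 0 < ⟪f y - f x, y - x⟫ := by
  have hmem (t : ℝ) (ht : t ∈ Set.Icc (0 : ℝ) 1) : x + t • (y - x) ∈ C :=
    hC.add_smul_sub_mem hx hy ht
  have hd (t : ℝ) (ht : t ∈ Set.Icc (0 : ℝ) 1) :
      HasDerivAt (fun t : ℝ => ⟪f (x + t • (y - x)), y - x⟫)
        ⟪f' (x + t • (y - x)) (y - x), y - x⟫ t := by
    have hl : HasDerivAt (fun t : ℝ => x + t • (y - x)) (y - x) t := by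
      simpa using ((hasDerivAt_id t).smul_const (y - x)).const_add x
    have := ((hf _ (hmem t ht)).comp_hasDerivAt t hl).inner ℝ (hasDerivAt_const t (y - x))
    simpa using this
  have hmono : StrictMonoOn (fun t : ℝ => ⟪f (x + t • (y - x)), y - x⟫) (Set.Icc 0 1) := by
    refine strictMonoOn_of_deriv_pos (convex_Icc 0 1)
      (fun t ht => (hd t ht).continuousAt.continuousWithinAt) fun t ht => ?_
    have ht' := interior_subset ht
    rw [(hd t ht').deriv]
    exact hpos _ (hmem t ht') _ (sub_ne_zero.2 hxy.symm)
  have := hmono (Set.left_mem_Icc.2 zero_le_one) (Set.right_mem_Icc.2 zero_le_one) zero_lt_one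
  simp only [zero_smul, add_zero, one_smul, add_sub_cancel] at this
  rw [inner_sub_left]
  exact sub_pos.2 this

end Stress

end ChainLimited

theorem mainTheorem5 (α β γ κ : ℝ) (hα : 1 ≤ α) (hβ : (3 : ℝ) ^ (α / 2) < β)
    (hγ : 1 / 4 ≤ γ) :
    ChainLimited.Polyconvex (ChainLimited.chainEnergy α β γ κ) ∧
    Convex ℝ {F : ChainLimited.Mat | ChainLimited.frobNorm F ^ α < β} ∧
    Convex ℝ (ChainLimited.admissible (ChainLimited.chainEnergy α β γ κ)) ∧
    ChainLimited.TSTSMPlusPlus (ChainLimited.chainEnergy α β γ κ) ∧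
    ChainLimited.TSTSMPlus (ChainLimited.chainEnergy α β γ κ) := by
  open ChainLimited in
  have hα0 : 0 < α := by linarith
  have hdiff (X : Sym3) (hX : X ∈ admissible (chainEnergy α β γ κ)) :
      DifferentiableAt ℝ (energyHat (chainEnergy α β γ κ)) X :=
    (hasGradientAt_energyHat hα0.le hX).hasFDerivAt.differentiableAt
  have hD (X : Sym3) (hX : X ∈ admissible (chainEnergy α β γ κ)) :
      HasFDerivAt (cauchyStress (chainEnergy α β γ κ))
        (fderiv ℝ (cauchyStress (chainEnergy α β γ κ)) X) X ∧
      ∀ H, H ≠ 0 → 0 < inner ℝ (fderiv ℝ (cauchyStress (chainEnergy α β γ κ)) X H) H := by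
    obtain ⟨D, hD, hpos⟩ := exists_hasFDerivAt_cauchyStress_pos hα0 hγ hX
    rw [hD.fderiv]
    exact ⟨hD, hpos⟩
  have hC := convex_admissible hα β γ κ
  exact ⟨polyconvex_chainEnergy hα (by linarith) β κ, convex_setOf_frobNorm_rpow_lt hα β, hC,
    fun X hX => ⟨hdiff X hX, (hD X hX).1.differentiableAt, (hD X hX).2⟩,
    hdiff, fun X hX Y hY hXY => inner_sub_pos_of_hasFDerivAt_pos hC (fun Z hZ => (hD Z hZ).1)
      (fun Z hZ => (hD Z hZ).2) hX hY hXY⟩
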